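/- **Setting.** Fix $d$ and a Lipschitz constant $G>0$. In each round $t=1,2,\dots$ the learner predicts $x_t\in\mathbb R^d$; an adaptive environment $\mathcal E$, knowing $x_1,\dots,x_t$, reveals a convex loss $l_t:\mathbb R^d\to\mathbb R$ that is $G$-Lipschitz for $\|\cdot\|_2$, and the learner observes some subgradient $g_t\in\partial l_t(x_t)$. For a comparator sequence $u_{1:T}\in\mathbb R^{dT}$ the unconstrained dynamic regret is $$\mathrm{Reg}_T(u_{1:T})=\sup_{\mathcal E}\Big[\sum_{t=1}^T l_t(x_t)-\sum_{t=1}^T l_t(u_t)\Big].$$ **Algorithm (anytime Haar OLR).** FreeGrad with hyperparameter $\varepsilon>0$, after receiving gradients $\hat g_1,\dots,\hat g_n\in\mathbb R^d$, outputs, with $s=\sum_i\hat g_i$ and $v=G^2+\sum_i\|\hat g_i\|_2^2$, $$\hat x=-\varepsilon s\cdot\frac{(2v+G\|s\|_2)G^2}{2(v+G\|s\|_2)^2\sqrt v}\exp\Big(\frac{\|s\|_2^2}{2v+2G\|s\|_2}\Big).$$ For $m\ge1$ the Haar dictionary of length $2^m$ consists of the all-one feature and, for $j\in\{1,\dots,m\}$,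 $l\in\{1,\dots,2^{m-j}\}$, the feature $h^{(j,l)}$ with entries $1$ for $2^j(l-1)<t\le 2^j(l-1)+2^{j-1}$, $-1$ for $2^j(l-1)+2^{j-1}<t\le 2^jl$, and $0$ otherwise. Haar OLR with horizon $2^m$ and hyperparameter $\varepsilon$ runs, for each of the $2^m$ features $h$, its own copy of FreeGrad with hyperparameter $\varepsilon/2^m$; the copy is used only in rounds with $h_t\ne0$, where its output $\hat x_{t,h}$ contributes $h_t\hat x_{t,h}$ to the prediction $x_t=\sum_h h_t\hat x_{t,h}$ and it is fed the gradient $h_tg_t$. Anytime Haar OLR runs, for $m=1,2,\dots$ in turn, a fresh copy of Haar OLR with horizon $2^m$ and $\varepsilon=1$ for $2^m$ rounds. **Theorem 3 (Path length bound).** Let $\bar u=\frac1T\sum_{t=1}^Tu_t$, $P=\sum_{t=1}^{T-1}\|u_{t+1}-u_t\|_2$, $\bar S=\sum_{t=1}^T\|u_t-\bar u\|_2$ and $M=\max_t\|u_t\|_2$. There are absolute constants $C>0$ and $k\in\mathbb N$ such that for all $d$, all $G>0$, all $T\ge1$ and all $u_{1:T}\in\mathbb R^{dT}$, anytime Haar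 OLR guarantees $$\mathrm{Reg}_T(u_{1:T})\le C\,G\log(T+1)+C\,G\Big(\|\bar u\|_2\sqrt T+\sqrt{P\bar S}\Big)\big(\log(2+M+T)\big)^k,$$ that is, $\mathrm{Reg}_T(u_{1:T})\le\tilde O\big(\|\bar u\|_2\sqrt T+\sqrt{P\bar S}\big)$. -/

import Mathlib

/-!
Unconstrained dynamic online convex optimization, the FreeGrad static learner, and the anytime
Haar online-linear-regression algorithm.
-/

noncomputable section

namespace HaarOLR

/-- The decision space `ℝ^d` with the Euclidean norm. -/
abbrev Vec (d : ℕ) : Type := EuclideanSpace ℝ (Fin d)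

/-! ### The game -/

/-- A deterministic learner with first-order feedback: its prediction in a round is a function of
the list of loss (sub)gradients `g_1, …, g_{t-1}` of the previous rounds, in chronological order. -/
abbrev Learner (d : ℕ) : Type := List (Vec d) → Vec d

/-- An adaptive adversarial environment with `G`-Lipschitz convex losses.  In every round it sees
the list `past` of the previous predictions `x_1, …, x_{t-1}` and the current prediction `x = x_t`;
it reveals a convex `G`-Lipschitz loss `l_t`, of which the learner observes one subgradient
at `x_t`, chosen arbitrarily by the environment. -/
structure Environment (d : ℕ) (G : ℝ) where
  /-- the loss function `l_t` -/
  loss : (past : List (Vec d)) → (x : Vec d) → Vec d → ℝ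
  /-- the observed subgradient `g_t ∈ ∂ l_t(x_t)` -/
  grad : (past : List (Vec d)) → (x : Vec d) → Vec d
  convex : ∀ past x, ConvexOn ℝ Set.univ (loss past x)
  lipschitz : ∀ past x, LipschitzWith (Real.toNNReal G) (loss past x)
  subgradient : ∀ past x y,
    loss past x x + inner ℝ (grad past x) (y - x) ≤ loss past x y

variable {d : ℕ} {G : ℝ}

/-- The predictions and the observed subgradients of the first `t` rounds. -/
def play (A : Learner d) (env : Environment d G) : ℕ → List (Vec d) × List (Vec d)
  | 0 => ([], [])
  | t + 1 =>
    let h := play A env t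
    let x := A h.2
    (h.1 ++ [x], h.2 ++ [env.grad h.1 x])

/-- The prediction made after `t` completed rounds, i.e. `x_{t+1}`. -/
def prediction (A : Learner d) (env : Environment d G) (t : ℕ) : Vec d :=
  A (play A env t).2

/-- The loss function revealed after `t` completed rounds, i.e. `l_{t+1}`. -/
def lossAt (A : Learner d) (env : Environment d G) (t : ℕ) : Vec d → ℝ :=
  env.loss (play A env t).1 (prediction A env t)

/-- The unconstrained dynamic regret
`sup_env (∑_{t=1}^T l_t(x_t) - ∑_{t=1}^T l_t(u_t))`, as an extended real number. -/
def regret (A : Learner d) (G : ℝ) {T : ℕ} (u : Fin T → Vec d) : EReal :=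
  ⨆ env : Environment d G,
    (((∑ t : Fin T, lossAt A env t (prediction A env t)
      - ∑ t : Fin T, lossAt A env t (u t) : ℝ)) : EReal)

/-! ### Statistics of the comparator sequence -/

/-- The comparator average `ū`. -/
def average {T : ℕ} (u : Fin T → Vec d) : Vec d := (T : ℝ)⁻¹ • ∑ t, u t

/-- The path length `P = ∑_{t=1}^{T-1} ‖u_{t+1} - u_t‖`. -/
def pathLength {T : ℕ} (u : Fin T → Vec d) : ℝ :=
  ∑ t : Fin (T - 1), ‖u ⟨(t : ℕ) + 1, by omega⟩ - u ⟨(t : ℕ), by omega⟩‖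

/-- The first order variability `S̄ = ∑_{t=1}^T ‖u_t - ū‖`. -/
def variability {T : ℕ} (u : Fin T → Vec d) : ℝ :=
  (∑ t : Fin T, ‖u t - average u‖)

/-- The maximum range `M = max_t ‖u_t‖`. -/
def maxRange {T : ℕ} (u : Fin T → Vec d) : ℝ :=
  (⨆ t : Fin T, ‖u t‖)

/-! ### FreeGrad -/

/-- The `d`-dimensional FreeGrad learner with hyperparameter `ε` and Lipschitz constant `G`:
with `s` the sum of the observed gradients and `v = G² +` the sum of their squared norms. -/
def freeGrad (ε G : ℝ) : Learner d := fun gs =>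
  let s : Vec d := gs.sum
  let v : ℝ := G ^ 2 + (gs.map fun g => ‖g‖ ^ 2).sum
  let c : ℝ := -ε * ((2 * v + G * ‖s‖) * G ^ 2 / (2 * (v + G * ‖s‖) ^ 2 * √v))
    * Real.exp (‖s‖ ^ 2 / (2 * v + 2 * G * ‖s‖))
  c • s

/-! ### The Haar dictionary -/

/-- The `t`-th entry (`t ≥ 1`) of the Haar feature with scale `j ≥ 1` and location `l ≥ 1`. -/
def haarFeature (j l t : ℕ) : ℝ :=
  if t ∈ Finset.Icc (2 ^ j * (l - 1) + 1) (2 ^ j * (l - 1) + 2 ^ (j - 1)) then 1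
  else if t ∈ Finset.Icc (2 ^ j * (l - 1) + 2 ^ (j - 1) + 1) (2 ^ j * l) then -1
  else 0

/-- The all-one feature. -/
def oneFeature (_t : ℕ) : ℝ := 1

/-! ### The Haar OLR algorithm -/

/-- The surrogate gradients `h_i g_i` that are sent to the static learner attached to the feature
`h`: only the rounds `i` with `h_i ≠ 0` (rounds numbered from `1`) are kept. -/
def surrogateGrads (h : ℕ → ℝ) (gs : List (Vec d)) : List (Vec d) :=
  (gs.zipIdx 1).filterMap fun p => if h p.2 ≠ 0 then some (h p.2 • p.1) else none

/-- The contribution `w_t = h_t x̂_t` of one feature `h`, where `x̂_t` is the output of the copy of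
FreeGrad attached to `h` (if `h_t = 0` the contribution is `0` whatever `x̂_t` is). -/
def featureLearner (ε G : ℝ) (h : ℕ → ℝ) : Learner d := fun gs =>
  h (gs.length + 1) • freeGrad ε G (surrogateGrads h gs)

/-- Haar OLR with known horizon `2 ^ m`: one copy of FreeGrad with hyperparameter `ε / 2 ^ m` for
each of the `2 ^ m` features, the outputs being summed. -/
def haarFixed (m : ℕ) (ε G : ℝ) : Learner d := fun gs =>
  featureLearner (ε / 2 ^ m) G oneFeature gs
    + ∑ j ∈ Finset.Icc 1 m, ∑ l ∈ Finset.Icc 1 (2 ^ (m - j)),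
        featureLearner (ε / 2 ^ m) G (haarFeature j l) gs

/-- Anytime Haar OLR (doubling trick): for `m = 1, 2, …` a fresh copy of `haarFixed m 1 G` is run
for `2 ^ m` rounds.  The `m`-th block consists of the rounds `t` with
`2 ^ m - 1 ≤ t ≤ 2 ^ (m + 1) - 2`, so in round `t = gs.length + 1` the block is
`m = ⌊log₂ (t + 1)⌋`, and the `2 ^ m - 2` gradients of the earlier blocks are discarded. -/
def anytimeHaar (G : ℝ) : Learner d := fun gs =>
  let m := Nat.log 2 (gs.length + 2)
  haarFixed m 1 G (gs.drop (2 ^ m - 2))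

end HaarOLR

end

/-!
FreeGrad plays `-ε` times the gradient of its potential in the gradient sum, and after one more
gradient the potential is at most its linearisation before. To see this, split the gradient into its
parts parallel and orthogonal to the gradient sum; the orthogonal part is absorbed by the growth of
the variance, and along the parallel part the second order remainder of the exponent is a perfect
square. Duality turns this into a regret bound for every feature.

The comparator is the sum of its mean and of its Haar details, because successive dyadic means
telescope. A Haar coefficient is at most the local path length, and also at most the local
variability divided by the length of the support; the geometric mean of the two bounds and
Cauchy–Schwarz over the features of one scale produce `√(P S)`. Doubling costs one more logarithm.
-/

noncomputable section

namespace HaarOLR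

section Logarithm

lemma sub_sq_div_two_le_log_one_add {y : ℝ} (hy : 0 ≤ y) :
    y - y ^ 2 / 2 ≤ Real.log (1 + y) := by
  refine le_trans ?_ (Real.le_log_one_add_of_nonneg hy)
  rw [le_div_iff₀ (by positivity)]
  nlinarith [pow_nonneg hy 3]

lemma sub_sq_div_le_log_one_add_of_nonpos {y : ℝ} (hy : -1 < y) (hy0 : y ≤ 0) :
    y - y ^ 2 / (2 * (1 + y)) ≤ Real.log (1 + y) := by
  have hpos : 0 < 1 + y := by linarith
  have hsinh : Real.sinh (Real.log (1 + y)) = y - y ^ 2 / (2 * (1 + y)) := by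
    rw [Real.sinh_log hpos]
    field_simp
    ring
  rw [← hsinh]
  exact Real.sinh_le_self_iff.2 (Real.log_nonpos hpos.le (by linarith))

lemma sub_sq_div_two_le_log_one_add_of_abs_le {t q y : ℝ} (ht : t ≤ 1) (hq0 : 0 ≤ q) (hq1 : q ≤ 1)
    (hy : |y| ≤ t * (q - q ^ 2 / 2)) : y - (t * q) ^ 2 / 2 ≤ Real.log (1 + y) := by
  obtain ⟨z, hz⟩ : ∃ z, z = q - q ^ 2 / 2 := ⟨_, rfl⟩
  rw [← hz] at hy
  have hz0 : 0 ≤ z := by nlinarith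
  have hz1 : z ≤ 1 / 2 := by nlinarith [sq_nonneg (q - 1)]
  have hyz : |y| ≤ z := hy.trans (mul_le_of_le_one_left hz0 ht)
  have hy2 : y ^ 2 ≤ t ^ 2 * z ^ 2 := by
    rw [← mul_pow, ← sq_abs]
    gcongr
  have hzq : z ^ 2 ≤ q ^ 2 * (1 - z) := by
    have : q ^ 2 * (1 - z) - z ^ 2 = (q ^ 2) ^ 2 / 4 := by rw [hz]; ring
    linarith [sq_nonneg (q ^ 2)]
  have hyq : y ^ 2 ≤ (t * q) ^ 2 * (1 - z) := by
    linarith [mul_le_mul_of_nonneg_left hzq (sq_nonneg t)]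
  rcases le_total 0 y with h | h
  · refine le_trans ?_ (sub_sq_div_two_le_log_one_add h)
    nlinarith [mul_nonneg (sq_nonneg (t * q)) hz0]
  · have hzy : 1 - z ≤ 1 + y := by linarith [neg_le_of_abs_le hyz]
    have hdiv : y ^ 2 / (2 * (1 + y)) ≤ (t * q) ^ 2 / 2 := by
      rw [div_le_div_iff₀ (by linarith) two_pos]
      linarith [mul_le_mul_of_nonneg_left hzy (sq_nonneg (t * q))]
    linarith [sub_sq_div_le_log_one_add_of_nonpos (by linarith) h]

lemma div_two_mul_add_le_log {x v : ℝ} (hx : 0 ≤ x) (hv : 0 < v) :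
    x / (2 * v + x) ≤ Real.log (1 + x / v) / 2 := by
  have h := Real.le_log_one_add_of_nonneg (x := x / v) (by positivity)
  have htwo : 2 * (x / v) / (x / v + 2) = 2 * (x / (2 * v + x)) := by
    field_simp
    ring
  linarith

lemma div_two_mul_add_two_mul_le_log {x v : ℝ} (hx : 0 ≤ x) (hv : 0 < v) :
    x / (2 * (v + x)) ≤ Real.log (1 + x / v) / 2 := by
  refine le_trans ?_ (div_two_mul_add_le_log hx hv)
  gcongr
  linarith

end Logarithm

section Exponent

variable {G r v c : ℝ}

/-- The exponent `r² / (2 (v + G r))` of the FreeGrad potential at a gradient sum of norm `r`. -/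
def exponent (G r v : ℝ) : ℝ := r ^ 2 / (2 * v + 2 * G * r)

/-- The derivative of `exponent G r v` in `r`, that is, the logarithmic derivative of the FreeGrad
potential in the norm `r` of the gradient sum. -/
def exponentDeriv (G r v : ℝ) : ℝ := r * (2 * v + G * r) / (2 * (v + G * r) ^ 2)

lemma abs_mul_exponentDeriv (hG : 0 < G) (hr : 0 ≤ r) (hv : 0 < v) :
    |c * exponentDeriv G r v|
      = |c| / G * (G * r / (v + G * r) - (G * r / (v + G * r)) ^ 2 / 2) := by
  have hd : 0 ≤ exponentDeriv G r v := by unfold exponentDeriv; positivity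
  rw [abs_mul, abs_of_nonneg hd, exponentDeriv]
  field_simp
  ring

lemma one_add_mul_exponentDeriv_pos (hG : 0 < G) (hr : 0 ≤ r) (hv : 0 < v) (hc : |c| ≤ G) :
    0 < 1 + c * exponentDeriv G r v := by
  have h : |c * exponentDeriv G r v| ≤ 1 / 2 := by
    rw [abs_mul_exponentDeriv hG hr hv]
    set q := G * r / (v + G * r)
    have hcG : |c| / G ≤ 1 := (div_le_one hG).2 hc
    have : 0 ≤ |c| / G := by positivity
    nlinarith [sq_nonneg (q - 1)]
  linarith [neg_le_of_abs_le h]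

lemma sub_sq_le_log_one_add_mul_exponentDeriv (hG : 0 < G) (hr : 0 ≤ r) (hv : 0 < v)
    (hc : |c| ≤ G) :
    c * exponentDeriv G r v - (c * r / (v + G * r)) ^ 2 / 2
      ≤ Real.log (1 + c * exponentDeriv G r v) := by
  have hq1 : G * r / (v + G * r) ≤ 1 := (div_le_one (by positivity)).2 (by linarith)
  have h := sub_sq_div_two_le_log_one_add_of_abs_le ((div_le_one hG).2 hc) (by positivity) hq1
    (abs_mul_exponentDeriv hG hr hv).le
  have hcancel : |c| / G * (G * r / (v + G * r)) = |c| * r / (v + G * r) := by field_simp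
  rwa [hcancel, div_pow, mul_pow, sq_abs, ← mul_pow, ← div_pow] at h

lemma exponent_add_le_of_nonneg (hG : 0 < G) (hr : 0 ≤ r) (hv : 0 < v) (hc : |c| ≤ G)
    (hrc : 0 ≤ r + c) :
    exponent G (r + c) (v + c ^ 2) ≤ exponent G r v + c ^ 2 / (2 * v + c ^ 2)
      + (c * exponentDeriv G r v - (c * r / (v + G * r)) ^ 2 / 2) := by
  have : 0 < v + G * r := by positivity
  have : 0 < v + c ^ 2 + G * (r + c) := by positivity
  have hV : 0 < 2 * v + c ^ 2 := by positivity
  -- the remainder of the second order expansion is a perfect square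
  have key : exponent G (r + c) (v + c ^ 2) - exponent G r v
      - (c * exponentDeriv G r v - (c * r / (v + G * r)) ^ 2 / 2)
      = c ^ 2 * ((v - r * c) ^ 2 / (2 * (v + G * r) ^ 2 * (v + c ^ 2 + G * (r + c)))) := by
    unfold exponent exponentDeriv
    field_simp
    ring
  have hsq : (v - r * c) ^ 2 ≤ (v + G * r) ^ 2 := by
    have := abs_le.1 hc
    apply sq_le_sq' <;> nlinarith
  have hrem : (v - r * c) ^ 2 / (2 * (v + G * r) ^ 2 * (v + c ^ 2 + G * (r + c)))
      ≤ 1 / (2 * v + c ^ 2) := by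
    rw [div_le_div_iff₀ (by positivity) hV, one_mul]
    calc (v - r * c) ^ 2 * (2 * v + c ^ 2)
        ≤ (v + G * r) ^ 2 * (2 * (v + c ^ 2 + G * (r + c))) := by
          gcongr
          nlinarith [sq_nonneg c, mul_nonneg hG.le hrc]
      _ = _ := by ring
  have := mul_le_mul_of_nonneg_left hrem (sq_nonneg c)
  rw [mul_one_div] at this
  linarith

lemma three_mul_sq_sub_sq_mul_sub_half_le_cube {b s : ℝ} (hs : 0 ≤ s) (hsb : s ≤ b) :
    3 * (b ^ 2 - s ^ 2) * (s - b / 2) ≤ s ^ 3 := by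
  -- in `x = s / b` the claim is `0 ≤ 4 x ^ 3 - 3 x ^ 2 / 2 - 3 x + 3 / 2`, whose minimum, at
  -- `x ≈ 16 / 25`, is only slightly positive
  have : 0 ≤ (4 * s + 181 / 50 * b) * (s - 16 / 25 * b) ^ 2 := by
    have := hs.trans hsb
    positivity
  nlinarith [mul_nonneg (hs.trans hsb) (sq_nonneg b),
    mul_nonneg (sub_nonneg.2 hsb) (sq_nonneg b)]

/-- For a step of length `b` that carries a gradient sum of norm `r` past the origin, to norm
`b - r`. -/
lemma sub_sq_div_add_sq_sub_sq_div_le {b : ℝ} (hG : 0 < G) (hr : 0 ≤ r) (hv : G ^ 2 ≤ v)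
    (hb : b ≤ G) (hrb : r ≤ b) :
    (b - r) ^ 2 / (v + b ^ 2 + G * (b - r)) + (b ^ 2 - (b - r) ^ 2) / (v + G * r)
      ≤ 2 * b ^ 2 / (2 * v + b ^ 2) := by
  obtain ⟨s, rfl⟩ : ∃ s, r = b - s := ⟨b - r, by ring⟩
  have hs : 0 ≤ s := by linarith
  have hsb : s ≤ b := by linarith
  have : 0 ≤ b := hs.trans hsb
  have hv0 : 0 < v := (pow_pos hG 2).trans_le hv
  rw [sub_sub_cancel]
  obtain ⟨w, hw⟩ : ∃ w, w = v + G * (b - s) := ⟨_, rfl⟩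
  obtain ⟨W, hW⟩ : ∃ W, W = v + b ^ 2 + G * s := ⟨_, rfl⟩
  have hw0 : 0 < w := by rw [hw]; positivity
  have hW0 : 0 < W := by rw [hW]; positivity
  have hV0 : 0 < 2 * v + b ^ 2 := by positivity
  have hbb : b ^ 2 ≤ G * b := by nlinarith
  have hbs : 0 ≤ b ^ 2 - s ^ 2 := by nlinarith
  have hWw : W ≤ 3 * w := by nlinarith
  have key : (b ^ 2 - s ^ 2) * (b ^ 2 - 2 * G * (b - s)) * W ≤ s ^ 2 * (b ^ 2 + 2 * G * s) * w := by
    have hlin : b ^ 2 - 2 * G * (b - s) ≤ 2 * G * (s - b / 2) := by linarith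
    have hR : 0 ≤ s ^ 2 * (b ^ 2 + 2 * G * s) * w := by positivity
    rcases le_total s (b / 2) with h | h
    · refine le_trans ?_ hR
      have : b ^ 2 - 2 * G * (b - s) ≤ 0 := by nlinarith
      exact mul_nonpos_of_nonpos_of_nonneg (mul_nonpos_of_nonneg_of_nonpos hbs this) hW0.le
    · have : 0 ≤ s - b / 2 := by linarith
      calc (b ^ 2 - s ^ 2) * (b ^ 2 - 2 * G * (b - s)) * W
          ≤ (b ^ 2 - s ^ 2) * (2 * G * (s - b / 2)) * (3 * w) := by gcongr
        _ = 2 * G * w * (3 * (b ^ 2 - s ^ 2) * (s - b / 2)) := by ring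
        _ ≤ 2 * G * w * s ^ 3 := by
          gcongr
          exact three_mul_sq_sub_sq_mul_sub_half_le_cube hs hsb
        _ ≤ s ^ 2 * (b ^ 2 + 2 * G * s) * w := by
          linarith [mul_nonneg (mul_nonneg (sq_nonneg s) (sq_nonneg b)) hw0.le]
  rw [← hw, ← hW, div_add_div _ _ hW0.ne' hw0.ne', div_le_div_iff₀ (by positivity) hV0]
  rw [hw, hW] at key ⊢
  linarith

lemma exponent_add_le_of_nonpos (hG : 0 < G) (hr : 0 ≤ r) (hv : G ^ 2 ≤ v) (hc : |c| ≤ G)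
    (hrc : r + c ≤ 0) :
    exponent G (-(r + c)) (v + c ^ 2) ≤ exponent G r v + c ^ 2 / (2 * v + c ^ 2)
      + (c * exponentDeriv G r v - (c * r / (v + G * r)) ^ 2 / 2) := by
  obtain ⟨b, rfl⟩ : ∃ b, c = -b := ⟨-c, by ring⟩
  have hb : b ≤ G := by linarith [neg_le_of_abs_le hc]
  have : 0 ≤ b := by linarith
  have hv0 : 0 < v := (pow_pos hG 2).trans_le hv
  have : 0 < v + G * r := by positivity
  have hlin : b * exponentDeriv G r v + (b * r / (v + G * r)) ^ 2 / 2 ≤ b * r / (v + G * r) := by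
    have : b * r / (v + G * r) - b * exponentDeriv G r v - (b * r / (v + G * r)) ^ 2 / 2
        = b * (G - b) * r ^ 2 / (2 * (v + G * r) ^ 2) := by
      unfold exponentDeriv
      field_simp
      ring
    have h0 : 0 ≤ b * (G - b) * r ^ 2 / (2 * (v + G * r) ^ 2) := by
      have := sub_nonneg.2 hb
      positivity
    linarith
  have key := sub_sq_div_add_sq_sub_sq_div_le hG hr hv hb (by linarith)
  have hnew : exponent G (-(r + -b)) (v + (-b) ^ 2)
      = (b - r) ^ 2 / (v + b ^ 2 + G * (b - r)) / 2 := by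
    rw [exponent, div_div]
    congr 1 <;> ring
  have hold : (b ^ 2 - (b - r) ^ 2) / (v + G * r) / 2 = b * r / (v + G * r) - exponent G r v := by
    unfold exponent
    field_simp
    ring
  have hhalf : 2 * b ^ 2 / (2 * v + b ^ 2) / 2 = b ^ 2 / (2 * v + b ^ 2) := by ring
  have hneg : (-b * r / (v + G * r)) ^ 2 = (b * r / (v + G * r)) ^ 2 := by ring
  rw [hnew, hneg, neg_sq]
  linarith

lemma exponent_abs_add_le (hG : 0 < G) (hr : 0 ≤ r) (hv : G ^ 2 ≤ v) (hc : |c| ≤ G) :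
    exponent G |r + c| (v + c ^ 2) ≤ exponent G r v + Real.log (1 + c ^ 2 / v) / 2
      + Real.log (1 + c * exponentDeriv G r v) := by
  have hv0 : 0 < v := (pow_pos hG 2).trans_le hv
  have hquad := div_two_mul_add_le_log (sq_nonneg c) hv0
  have hlin := sub_sq_le_log_one_add_mul_exponentDeriv hG hr hv0 hc
  rcases le_total 0 (r + c) with h | h
  · rw [abs_of_nonneg h]
    linarith [exponent_add_le_of_nonneg hG hr hv0 hc h]
  · rw [abs_of_nonpos h]
    linarith [exponent_add_le_of_nonpos hG hr hv hc h]

lemma exponent_le_of_sq_add_sq {ρ x : ℝ} (hG : 0 ≤ G) (hr : 0 ≤ r) (hv : 0 < v) (hρ : 0 ≤ ρ)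
    (hρr : ρ ^ 2 = r ^ 2 + x ^ 2) :
    exponent G ρ (v + x ^ 2) ≤ exponent G r v + Real.log (1 + x ^ 2 / v) / 2 := by
  have hrρ : r ≤ ρ := (sq_le_sq₀ hr hρ).1 (by nlinarith)
  have h := div_two_mul_add_two_mul_le_log (sq_nonneg x) hv
  calc exponent G ρ (v + x ^ 2)
      = r ^ 2 / (2 * (v + x ^ 2) + 2 * G * ρ) + x ^ 2 / (2 * (v + x ^ 2) + 2 * G * ρ) := by
        rw [exponent, hρr, add_div]
    _ ≤ r ^ 2 / (2 * v + 2 * G * r) + x ^ 2 / (2 * (v + x ^ 2)) := by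
        gcongr
        · linarith [sq_nonneg x]
        · linarith [mul_nonneg hG hρ]
    _ ≤ _ := by rw [exponent]; linarith

end Exponent

section Potential

variable {E : Type*} [SeminormedAddCommGroup E] {G v : ℝ} {s g : E}

/-- The FreeGrad potential at gradient sum `s` and variance `v`; FreeGrad plays `-ε` times its
gradient in `s`. -/
def potential (G : ℝ) (s : E) (v : ℝ) : ℝ := G ^ 2 * Real.exp (exponent G ‖s‖ v) / √v

/-- The factor of `s` in the gradient of the FreeGrad potential. -/
def potentialSlope (G : ℝ) (s : E) (v : ℝ) : ℝ :=
  (2 * v + G * ‖s‖) * G ^ 2 / (2 * (v + G * ‖s‖) ^ 2 * √v) * Real.exp (exponent G ‖s‖ v)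

lemma potentialSlope_mul_norm (hv : 0 < v) :
    potentialSlope G s v * ‖s‖ = potential G s v * exponentDeriv G ‖s‖ v := by
  unfold potentialSlope potential exponentDeriv
  field_simp

lemma potential_le_mul_of_exponent_le {s' : E} {x y : ℝ} (hv : 0 < v) (hx : 0 ≤ x)
    (hy : 0 < 1 + y)
    (h : exponent G ‖s'‖ (v + x)
      ≤ exponent G ‖s‖ v + Real.log (1 + x / v) / 2 + Real.log (1 + y)) :
    potential G s' (v + x) ≤ potential G s v * (1 + y) := by
  have hexp := Real.exp_le_exp.2 h
  rw [Real.exp_add, Real.exp_add, Real.exp_log hy, Real.exp_half,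
    Real.exp_log (by positivity)] at hexp
  have hsqrt : √(v + x) = √v * √(1 + x / v) := by
    rw [← Real.sqrt_mul hv.le, mul_one_add, mul_div_cancel₀ _ hv.ne']
  rw [potential, potential, hsqrt, div_le_iff₀ (by positivity)]
  calc G ^ 2 * Real.exp (exponent G ‖s'‖ (v + x))
      ≤ G ^ 2 * (Real.exp (exponent G ‖s‖ v) * √(1 + x / v) * (1 + y)) := by gcongr
    _ = _ := by field_simp

section InnerProductSpace

variable [InnerProductSpace ℝ E]

lemma potential_add_smul_le {a : ℝ} (hG : 0 < G) (hv : G ^ 2 ≤ v) (ha : ‖a • s‖ ≤ G) :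
    potential G (s + a • s) (v + ‖a • s‖ ^ 2)
      ≤ potential G s v + potentialSlope G s v * inner ℝ (a • s) s := by
  have hv0 : 0 < v := (pow_pos hG 2).trans_le hv
  have hc : |a * ‖s‖| = ‖a • s‖ := by rw [norm_smul, abs_mul, abs_norm, Real.norm_eq_abs]
  have hnorm : ‖s + a • s‖ = |‖s‖ + a * ‖s‖| := by
    nth_rw 1 [← one_smul ℝ s]
    rw [← add_smul, norm_smul, ← one_add_mul, abs_mul, abs_norm, Real.norm_eq_abs]
  rw [← hc] at ha
  calc potential G (s + a • s) (v + ‖a • s‖ ^ 2)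
      ≤ potential G s v * (1 + a * ‖s‖ * exponentDeriv G ‖s‖ v) := by
        apply potential_le_mul_of_exponent_le hv0 (sq_nonneg _)
          (one_add_mul_exponentDeriv_pos hG (norm_nonneg s) hv0 ha)
        rw [← hc, sq_abs, hnorm]
        exact exponent_abs_add_le hG (norm_nonneg s) hv ha
    _ = potential G s v + potentialSlope G s v * ‖s‖ * (a * ‖s‖) := by
        rw [potentialSlope_mul_norm hv0]; ring
    _ = potential G s v + potentialSlope G s v * inner ℝ (a • s) s := by
        rw [real_inner_smul_left, real_inner_self_eq_norm_sq]; ring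

lemma norm_add_sq_of_inner_eq_zero {x y : E} (h : inner ℝ x y = 0) :
    ‖x + y‖ ^ 2 = ‖x‖ ^ 2 + ‖y‖ ^ 2 := by
  rw [norm_add_sq_real, h, mul_zero, add_zero]

lemma potential_add_le_of_inner_eq_zero (hG : 0 ≤ G) (hv : 0 < v) (h : inner ℝ s g = 0) :
    potential G (s + g) (v + ‖g‖ ^ 2) ≤ potential G s v := by
  have hexp := exponent_le_of_sq_add_sq hG (norm_nonneg s) hv (norm_nonneg (s + g))
    (norm_add_sq_of_inner_eq_zero h)
  simpa using potential_le_mul_of_exponent_le (y := 0) hv (sq_nonneg ‖g‖) (by simp)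
    (by simpa using hexp)

lemma potential_add_le (hG : 0 < G) (hv : G ^ 2 ≤ v) (hg : ‖g‖ ≤ G) :
    potential G (s + g) (v + ‖g‖ ^ 2)
      ≤ potential G s v + potentialSlope G s v * inner ℝ g s := by
  have hv0 : 0 < v := (pow_pos hG 2).trans_le hv
  obtain ⟨a, ha⟩ : ∃ a : ℝ, inner ℝ s (g - a • s) = 0 := by
    refine ⟨inner ℝ s g / ‖s‖ ^ 2, ?_⟩
    rw [inner_sub_right, real_inner_smul_right, real_inner_self_eq_norm_sq,
      div_mul_cancel_of_imp, sub_self]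
    intro hs
    exact inner_eq_zero_of_left g (pow_eq_zero_iff two_ne_zero |>.1 hs)
  obtain ⟨h, rfl⟩ : ∃ h, g = a • s + h := ⟨g - a • s, by abel⟩
  rw [add_sub_cancel_left] at ha
  have hsplit : ‖a • s + h‖ ^ 2 = ‖a • s‖ ^ 2 + ‖h‖ ^ 2 :=
    norm_add_sq_of_inner_eq_zero (by rw [real_inner_smul_left, ha, mul_zero])
  have hpar : ‖a • s‖ ≤ G := by
    refine le_trans ?_ hg
    rw [← sq_le_sq₀ (norm_nonneg _) (norm_nonneg _), hsplit]
    linarith [sq_nonneg ‖h‖]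
  calc potential G (s + (a • s + h)) (v + ‖a • s + h‖ ^ 2)
      = potential G (s + a • s + h) (v + ‖a • s‖ ^ 2 + ‖h‖ ^ 2) := by
        rw [hsplit, ← add_assoc, ← add_assoc]
    _ ≤ potential G (s + a • s) (v + ‖a • s‖ ^ 2) :=
        potential_add_le_of_inner_eq_zero hG.le (by positivity)
          (by rw [inner_add_left, real_inner_smul_left, ha, mul_zero, add_zero])
    _ ≤ potential G s v + potentialSlope G s v * inner ℝ (a • s) s :=
        potential_add_smul_le hG hv hpar
    _ = _ := by rw [inner_add_left (a • s) h, real_inner_comm s h, ha, add_zero]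

end InnerProductSpace

lemma le_add_sqrt_of_sq_le {x b c : ℝ} (hb : 0 ≤ b) (hc : 0 ≤ c) (h : x ^ 2 ≤ b * x + c) :
    x ≤ b + √c := by
  by_contra! hlt
  nlinarith [Real.sq_sqrt hc, Real.sqrt_nonneg c]

lemma norm_mul_sub_potential_le {ε U L : ℝ} (hG : 0 ≤ G) (hv : 0 < v) (hε : 0 ≤ ε) (hU : 0 ≤ U)
    (hL : 0 ≤ L) (h : ‖s‖ * U * √v ≤ ε * G ^ 2 * Real.exp L) :
    ‖s‖ * U - ε * potential G s v ≤ U * (2 * L * G + √(2 * L * v)) := by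
  have hpot : 0 ≤ ε * potential G s v := by unfold potential; positivity
  rcases le_total L (exponent G ‖s‖ v) with hle | hle
  · have : ‖s‖ * U ≤ ε * potential G s v := by
      rw [potential, ← mul_div_assoc, le_div_iff₀ (by positivity), ← mul_assoc]
      exact h.trans (by gcongr)
    have : 0 ≤ U * (2 * L * G + √(2 * L * v)) := by positivity
    linarith
  · have hsq : ‖s‖ ^ 2 ≤ 2 * L * G * ‖s‖ + 2 * L * v := by
      rw [exponent, div_le_iff₀ (by positivity)] at hle
      linarith
    have := mul_le_mul_of_nonneg_left
      (le_add_sqrt_of_sq_le (by positivity) (by positivity) hsq) hU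
    linarith

/-- The FreeGrad variance `G² + ∑ ‖g‖²` of a list of gradients. -/
def variance (G : ℝ) (gs : List E) : ℝ := G ^ 2 + (gs.map fun g => ‖g‖ ^ 2).sum

lemma sq_le_variance (gs : List E) : G ^ 2 ≤ variance G gs :=
  le_add_of_nonneg_right (List.sum_nonneg (by simp))

lemma variance_pos (hG : 0 < G) (gs : List E) : 0 < variance G gs :=
  (pow_pos hG 2).trans_le (sq_le_variance gs)

lemma variance_append_singleton (gs : List E) (g : E) :
    variance G (gs ++ [g]) = variance G gs + ‖g‖ ^ 2 := by
  simp [variance, add_assoc]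

lemma variance_le {gs : List E} (hgs : ∀ g ∈ gs, ‖g‖ ≤ G) :
    variance G gs ≤ G ^ 2 * (gs.length + 1) := by
  have h : (gs.map fun g => ‖g‖ ^ 2).sum ≤ gs.length * G ^ 2 := by
    simpa using List.sum_le_card_nsmul (gs.map fun g => ‖g‖ ^ 2) (G ^ 2)
      (by simpa using fun g hg => pow_le_pow_left₀ (norm_nonneg g) (hgs g hg) 2)
  rw [variance]
  linarith

lemma norm_list_sum_le {gs : List E} (hgs : ∀ g ∈ gs, ‖g‖ ≤ G) : ‖gs.sum‖ ≤ gs.length * G := by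
  refine le_trans (by simpa using norm_multiset_sum_le (gs : Multiset E)) ?_
  simpa using List.sum_le_card_nsmul (gs.map (‖·‖)) G (by simpa using hgs)

/-- The FreeGrad potential of a list of gradients. -/
def listPotential (G : ℝ) (gs : List E) : ℝ := potential G gs.sum (variance G gs)

lemma listPotential_nil (hG : 0 < G) : listPotential G ([] : List E) = G := by
  simp only [listPotential, potential, exponent, variance, List.map_nil, List.sum_nil, norm_zero,
    ne_eq, OfNat.ofNat_ne_zero, not_false_eq_true, zero_pow, zero_div, Real.exp_zero, mul_one,
    add_zero, Real.sqrt_sq hG.le]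
  field_simp

lemma freeGrad_eq_smul {d : ℕ} (ε : ℝ) (gs : List (Vec d)) :
    freeGrad ε G gs = (-ε * potentialSlope G gs.sum (variance G gs)) • gs.sum := by
  simp only [freeGrad, potentialSlope, exponent, variance, mul_assoc]

lemma inner_freeGrad_le {d : ℕ} {ε : ℝ} (hε : 0 ≤ ε) (hG : 0 < G) (gs : List (Vec d)) {g : Vec d}
    (hg : ‖g‖ ≤ G) :
    inner ℝ g (freeGrad ε G gs) ≤ ε * (listPotential G gs - listPotential G (gs ++ [g])) := by
  have h := mul_le_mul_of_nonneg_left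
    (potential_add_le (s := gs.sum) hG (sq_le_variance gs) hg) hε
  rw [listPotential, listPotential, variance_append_singleton, List.sum_append, List.sum_singleton,
    freeGrad_eq_smul, real_inner_smul_right]
  linarith

end Potential

section FeatureLearner

/-- The first `n` terms of a sequence, as a list. -/
def initSeg {α : Type*} (g : ℕ → α) (n : ℕ) : List α := (List.range n).map g

lemma length_initSeg {α : Type*} (g : ℕ → α) (n : ℕ) : (initSeg g n).length = n := by
  simp [initSeg]

lemma initSeg_succ {α : Type*} (g : ℕ → α) (n : ℕ) :
    initSeg g (n + 1) = initSeg g n ++ [g n] := by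
  simp [initSeg, List.range_succ]

lemma drop_initSeg_add {α : Type*} (g : ℕ → α) (k n : ℕ) :
    (initSeg g (k + n)).drop k = initSeg (fun i => g (k + i)) n := by
  unfold initSeg
  rw [List.range_add, List.map_append, List.drop_left' (by simp), List.map_map]
  rfl

lemma norm_smul_le_of_abs_le_one {E : Type*} [SeminormedAddCommGroup E] [NormedSpace ℝ E]
    {a B : ℝ} {x : E} (ha : |a| ≤ 1) (hx : ‖x‖ ≤ B) : ‖a • x‖ ≤ B := by
  rw [norm_smul, Real.norm_eq_abs]
  exact (mul_le_of_le_one_left (norm_nonneg x) ha).trans hx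

variable {d n K : ℕ} {G ε L : ℝ} {h : ℕ → ℝ} {g : ℕ → Vec d}

lemma surrogateGrads_initSeg_zero (h : ℕ → ℝ) (g : ℕ → Vec d) :
    surrogateGrads h (initSeg g 0) = [] := rfl

lemma surrogateGrads_initSeg_succ (h : ℕ → ℝ) (g : ℕ → Vec d) (n : ℕ) :
    surrogateGrads h (initSeg g (n + 1)) = surrogateGrads h (initSeg g n)
      ++ (if h (n + 1) ≠ 0 then [h (n + 1) • g n] else []) := by
  unfold surrogateGrads
  rw [initSeg_succ, List.zipIdx_append, List.filterMap_append, length_initSeg, add_comm 1 n]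
  by_cases hn : h (n + 1) = 0 <;> simp [hn]

lemma length_surrogateGrads_initSeg (h : ℕ → ℝ) (g : ℕ → Vec d) (n : ℕ) :
    (surrogateGrads h (initSeg g n)).length
      = ((Finset.range n).filter fun i => h (i + 1) ≠ 0).card := by
  induction n with
  | zero => simp [surrogateGrads_initSeg_zero]
  | succ n ih =>
    rw [surrogateGrads_initSeg_succ, List.length_append, ih, Finset.range_add_one,
      Finset.filter_insert]
    by_cases hn : h (n + 1) = 0 <;> simp [hn]

lemma sum_surrogateGrads_initSeg (h : ℕ → ℝ) (g : ℕ → Vec d) (n : ℕ) :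
    (surrogateGrads h (initSeg g n)).sum = ∑ i ∈ Finset.range n, h (i + 1) • g i := by
  induction n with
  | zero => simp [surrogateGrads_initSeg_zero]
  | succ n ih =>
    rw [surrogateGrads_initSeg_succ, List.sum_append, ih, Finset.sum_range_succ]
    by_cases hn : h (n + 1) = 0 <;> simp [hn]

lemma norm_le_of_mem_surrogateGrads {gs : List (Vec d)} (hh : ∀ i, |h i| ≤ 1)
    (hgs : ∀ x ∈ gs, ‖x‖ ≤ G) : ∀ x ∈ surrogateGrads h gs, ‖x‖ ≤ G := by
  intro x hx
  obtain ⟨⟨y, i⟩, hy, hyx⟩ := List.mem_filterMap.1 hx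
  obtain ⟨-, hyx⟩ := Option.ite_none_right_eq_some.1 hyx
  obtain ⟨_, _, hy⟩ := List.mem_zipIdx hy
  rw [← Option.some.inj hyx]
  exact norm_smul_le_of_abs_le_one (hh i) (hgs y (hy ▸ List.getElem_mem _))

lemma sum_inner_featureLearner_le (hG : 0 < G) (hε : 0 ≤ ε) (hh : ∀ i, |h i| ≤ 1)
    (hg : ∀ i, ‖g i‖ ≤ G) (n : ℕ) :
    ∑ i ∈ Finset.range n, inner ℝ (g i) (featureLearner ε G h (initSeg g i))
      ≤ ε * (G - listPotential G (surrogateGrads h (initSeg g n))) := by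
  induction n with
  | zero => simp [surrogateGrads_initSeg_zero, listPotential_nil hG]
  | succ n ih =>
    rw [Finset.sum_range_succ, surrogateGrads_initSeg_succ, featureLearner, length_initSeg]
    by_cases hn : h (n + 1) = 0
    · simpa [hn] using ih
    · rw [if_pos hn, real_inner_smul_right, ← real_inner_smul_left]
      linarith [inner_freeGrad_le hε hG (surrogateGrads h (initSeg g n))
        (norm_smul_le_of_abs_le_one (hh (n + 1)) (hg n))]

lemma neg_inner_sum_sub_listPotential_le {E : Type*} [SeminormedAddCommGroup E]
    [InnerProductSpace ℝ E] {gs : List E} {u : E} (hG : 0 < G) (hε : 0 ≤ ε) (hL : 0 ≤ L)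
    (hgs : ∀ g ∈ gs, ‖g‖ ≤ G) (hK : gs.length ≤ K)
    (hu : ((K : ℝ) + 1) ^ 2 * ‖u‖ ≤ ε * Real.exp L) :
    -inner ℝ gs.sum u - ε * listPotential G gs
      ≤ G * (2 * L + √(2 * L)) * (‖u‖ * √(K + 1)) := by
  have hK' : (gs.length : ℝ) ≤ K := mod_cast hK
  have hone : 1 ≤ √((K : ℝ) + 1) := Real.one_le_sqrt.2 (by simp)
  have hsqrtK : √((K : ℝ) + 1) ≤ K + 1 := Real.sqrt_le_iff.2 ⟨by positivity, by nlinarith⟩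
  have hnorm : ‖gs.sum‖ ≤ (K + 1) * G := by
    refine (norm_list_sum_le hgs).trans ?_
    gcongr
    linarith
  have hvar : √(variance G gs) ≤ G * √(K + 1) := by
    rw [← Real.sqrt_sq hG.le, ← Real.sqrt_mul (sq_nonneg G), Real.sqrt_sq hG.le]
    exact Real.sqrt_le_sqrt ((variance_le hgs).trans (by gcongr))
  have hexp : ‖gs.sum‖ * ‖u‖ * √(variance G gs) ≤ ε * G ^ 2 * Real.exp L := by
    calc ‖gs.sum‖ * ‖u‖ * √(variance G gs)
        ≤ (K + 1) * G * ‖u‖ * (G * (K + 1)) := by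
          gcongr
          exact hvar.trans (by gcongr)
      _ = G ^ 2 * ((K + 1) ^ 2 * ‖u‖) := by ring
      _ ≤ G ^ 2 * (ε * Real.exp L) := by gcongr
      _ = ε * G ^ 2 * Real.exp L := by ring
  calc -inner ℝ gs.sum u - ε * listPotential G gs
      ≤ ‖gs.sum‖ * ‖u‖ - ε * potential G gs.sum (variance G gs) :=
        sub_le_sub_right (neg_le.2 (neg_le_of_abs_le (abs_real_inner_le_norm gs.sum u))) _
    _ ≤ ‖u‖ * (2 * L * G + √(2 * L * variance G gs)) :=
        norm_mul_sub_potential_le hG.le (variance_pos hG gs) hε (norm_nonneg u) hL hexp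
    _ ≤ ‖u‖ * (2 * L * G * √(K + 1) + √(2 * L) * (G * √(K + 1))) := by
        rw [Real.sqrt_mul (by positivity)]
        gcongr ‖u‖ * (?_ + √(2 * L) * ?_)
        exact le_mul_of_one_le_right (by positivity) hone
    _ = _ := by ring

lemma featureLearner_regret_le {u : Vec d} (hG : 0 < G) (hε : 0 ≤ ε) (hL : 0 ≤ L)
    (hh : ∀ i, |h i| ≤ 1) (hg : ∀ i, ‖g i‖ ≤ G)
    (hK : ((Finset.range n).filter fun i => h (i + 1) ≠ 0).card ≤ K)
    (hu : ((K : ℝ) + 1) ^ 2 * ‖u‖ ≤ ε * Real.exp L) :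
    ∑ i ∈ Finset.range n, inner ℝ (g i) (featureLearner ε G h (initSeg g i) - h (i + 1) • u)
      ≤ ε * G + G * (2 * L + √(2 * L)) * (‖u‖ * √(K + 1)) := by
  have hlearner := sum_inner_featureLearner_le hG hε hh hg n
  have hcomparator : ∑ i ∈ Finset.range n, inner ℝ (g i) (h (i + 1) • u)
      = inner ℝ (surrogateGrads h (initSeg g n)).sum u := by
    rw [sum_surrogateGrads_initSeg, sum_inner]
    simp only [real_inner_smul_left, real_inner_smul_right]
  have hmem : ∀ x ∈ surrogateGrads h (initSeg g n), ‖x‖ ≤ G :=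
    norm_le_of_mem_surrogateGrads hh (by simpa [initSeg] using fun i _ => hg i)
  have hfenchel := neg_inner_sum_sub_listPotential_le hG hε hL hmem
    ((length_surrogateGrads_initSeg h g n).trans_le hK) hu
  simp only [inner_sub_right, Finset.sum_sub_distrib]
  linarith

lemma sum_featureLearner_regret_le {ι : Type*} {s : Finset ι} {h : ι → ℕ → ℝ} {K : ι → ℕ}
    {u : ι → Vec d} (hG : 0 < G) (hε : 0 ≤ ε) (hL : 0 ≤ L) (hh : ∀ k i, |h k i| ≤ 1)
    (hg : ∀ i, ‖g i‖ ≤ G)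
    (hK : ∀ k ∈ s, ((Finset.range n).filter fun i => h k (i + 1) ≠ 0).card ≤ K k)
    (hu : ∀ k ∈ s, ((K k : ℝ) + 1) ^ 2 * ‖u k‖ ≤ ε * Real.exp L) :
    ∑ i ∈ Finset.range n, inner ℝ (g i)
        (∑ k ∈ s, featureLearner ε G (h k) (initSeg g i) - ∑ k ∈ s, h k (i + 1) • u k)
      ≤ s.card * (ε * G) + G * (2 * L + √(2 * L)) * ∑ k ∈ s, ‖u k‖ * √(K k + 1) := by
  simp only [← Finset.sum_sub_distrib, inner_sum]
  rw [Finset.sum_comm, ← nsmul_eq_mul, ← Finset.sum_const, Finset.mul_sum, ← Finset.sum_add_distrib]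
  exact Finset.sum_le_sum fun k hk =>
    featureLearner_regret_le hG hε hL (hh k) hg (hK k hk) (hu k hk)

end FeatureLearner

section Mean

variable {ι E : Type*} {s : Finset ι} {f : ι → E}

lemma inv_card_smul_sum_sub [AddCommGroup E] [Module ℝ E] (hs : s.Nonempty) (z : E) :
    (s.card : ℝ)⁻¹ • ∑ i ∈ s, f i - z = (s.card : ℝ)⁻¹ • ∑ i ∈ s, (f i - z) := by
  have hcard : (s.card : ℝ) ≠ 0 := Nat.cast_ne_zero.2 hs.card_ne_zero
  rw [Finset.sum_sub_distrib, smul_sub, Finset.sum_const, ← Nat.cast_smul_eq_nsmul ℝ, smul_smul,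
    inv_mul_cancel₀ hcard, one_smul]

variable [SeminormedAddCommGroup E] [NormedSpace ℝ E] {z : E}

lemma norm_inv_card_smul_sum_sub_le_sum (hs : s.Nonempty) :
    ‖(s.card : ℝ)⁻¹ • ∑ i ∈ s, f i - z‖ ≤ (s.card : ℝ)⁻¹ * ∑ i ∈ s, ‖f i - z‖ := by
  rw [inv_card_smul_sum_sub hs, norm_smul, norm_inv, Real.norm_natCast]
  gcongr
  exact norm_sum_le _ _

lemma norm_inv_card_smul_sum_sub_le (hs : s.Nonempty) {B : ℝ} (hB : ∀ i ∈ s, ‖f i - z‖ ≤ B) :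
    ‖(s.card : ℝ)⁻¹ • ∑ i ∈ s, f i - z‖ ≤ B := by
  refine (norm_inv_card_smul_sum_sub_le_sum hs).trans ?_
  rw [inv_mul_le_iff₀ (by exact_mod_cast hs.card_pos), ← nsmul_eq_mul]
  exact Finset.sum_le_card_nsmul s _ B hB

end Mean

section HaarTransform

lemma sum_range_sum_range_mul_add {M : Type*} [AddCommMonoid M] (f : ℕ → M) (p q : ℕ) :
    ∑ k ∈ Finset.range q, ∑ i ∈ Finset.range p, f (p * k + i)
      = ∑ i ∈ Finset.range (p * q), f i := by
  induction q with
  | zero => simp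
  | succ q ih => rw [Finset.sum_range_succ, ih, mul_add, mul_one, Finset.sum_range_add]

lemma sum_range_two_pow_succ {M : Type*} [AddCommMonoid M] (f : ℕ → M) (j k : ℕ) :
    ∑ i ∈ Finset.range (2 ^ (j + 1)), f (2 ^ (j + 1) * k + i)
      = ∑ i ∈ Finset.range (2 ^ j), f (2 ^ j * (2 * k) + i)
        + ∑ i ∈ Finset.range (2 ^ j), f (2 ^ j * (2 * k + 1) + i) := by
  rw [pow_succ, mul_two, Finset.sum_range_add]
  congr 1 <;> refine Finset.sum_congr rfl fun i _ => ?_ <;> congr 1 <;> ring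

lemma haarFeature_succ (j k i : ℕ) :
    haarFeature (j + 1) (k + 1) (i + 1)
      = if i / 2 ^ j = 2 * k then 1 else if i / 2 ^ j = 2 * k + 1 then -1 else 0 := by
  have hp : 0 < 2 ^ j := by positivity
  have hstart : 2 ^ (j + 1) * k = 2 * k * 2 ^ j := by ring
  have hend : 2 ^ (j + 1) * (k + 1) = 2 * k * 2 ^ j + 2 ^ j + 2 ^ j := by ring
  have hmid : (2 * k + 1) * 2 ^ j = 2 * k * 2 ^ j + 2 ^ j := by ring
  simp only [haarFeature, Finset.mem_Icc, Nat.div_eq_iff hp, Nat.add_sub_cancel, hstart, hend, hmid]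
  congr 1
  · simp only [eq_iff_iff]; omega
  · congr 1
    simp only [eq_iff_iff]; omega

lemma abs_haarFeature_le_one (j l t : ℕ) : |haarFeature j l t| ≤ 1 := by
  unfold haarFeature
  split_ifs <;> simp

lemma card_filter_haarFeature_le (j k n : ℕ) :
    ((Finset.range n).filter fun i => haarFeature (j + 1) (k + 1) (i + 1) ≠ 0).card
      ≤ 2 ^ (j + 1) := by
  have hsub : ((Finset.range n).filter fun i => haarFeature (j + 1) (k + 1) (i + 1) ≠ 0)
      ⊆ Finset.Ico (2 ^ (j + 1) * k) (2 ^ (j + 1) * k + 2 ^ (j + 1)) := by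
    intro i hi
    have hne := (Finset.mem_filter.1 hi).2
    have hdiv : i / 2 ^ (j + 1) = k := by
      rw [pow_succ, ← Nat.div_div_eq_div_mul]
      rw [haarFeature_succ] at hne
      by_contra! hk
      rw [if_neg (by omega), if_neg (by omega)] at hne
      exact hne rfl
    rw [Finset.mem_Ico, ← hdiv, ← Nat.mul_succ]
    exact ⟨Nat.mul_div_le _ _, Nat.lt_mul_div_succ _ (by positivity)⟩
  simpa using Finset.card_le_card hsub

variable {E : Type*}

section Module

variable [AddCommGroup E] [Module ℝ E]

/-- The mean of a sequence over the dyadic interval `[2 ^ j * k, 2 ^ j * (k + 1))`. -/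
def dyadicMean (w : ℕ → E) (j k : ℕ) : E :=
  (2 ^ j : ℝ)⁻¹ • ∑ i ∈ Finset.range (2 ^ j), w (2 ^ j * k + i)

/-- The coefficient of a sequence along the Haar feature of scale `j + 1` and location `k + 1`. -/
def haarCoeff (w : ℕ → E) (j k : ℕ) : E :=
  (2⁻¹ : ℝ) • (dyadicMean w j (2 * k) - dyadicMean w j (2 * k + 1))

lemma dyadicMean_zero (w : ℕ → E) (k : ℕ) : dyadicMean w 0 k = w k := by
  simp [dyadicMean]

lemma dyadicMean_succ (w : ℕ → E) (j k : ℕ) :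
    dyadicMean w (j + 1) k
      = (2⁻¹ : ℝ) • (dyadicMean w j (2 * k) + dyadicMean w j (2 * k + 1)) := by
  unfold dyadicMean
  rw [sum_range_two_pow_succ, ← smul_add, smul_smul, pow_succ, mul_inv, mul_comm]

lemma sum_haarFeature_smul_haarCoeff (w : ℕ → E) {m j i : ℕ} (hi : i < 2 ^ m) (hj : j < m) :
    ∑ k ∈ Finset.range (2 ^ (m - (j + 1))),
        haarFeature (j + 1) (k + 1) (i + 1) • haarCoeff w j k
      = dyadicMean w j (i / 2 ^ j) - dyadicMean w (j + 1) (i / 2 ^ (j + 1)) := by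
  obtain ⟨c, hc⟩ : ∃ c, c = i / 2 ^ j := ⟨_, rfl⟩
  have hdiv : i / 2 ^ (j + 1) = c / 2 := by rw [pow_succ, ← Nat.div_div_eq_div_mul, hc]
  have hlt : c / 2 < 2 ^ (m - (j + 1)) := by
    rw [← hdiv]
    apply Nat.div_lt_of_lt_mul
    rwa [← pow_add, Nat.add_sub_cancel' hj]
  rw [Finset.sum_eq_single_of_mem (c / 2) (Finset.mem_range.2 hlt)]
  · rw [haarFeature_succ, hdiv, ← hc, dyadicMean_succ, haarCoeff]
    rcases Nat.even_or_odd' c with ⟨q, hq | hq⟩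
    · rw [show c / 2 = q by omega, if_pos hq, hq]
      module
    · rw [show c / 2 = q by omega, if_neg (by omega), if_pos hq, hq]
      module
  · intro k _ hk
    rw [haarFeature_succ, ← hc, if_neg (by omega), if_neg (by omega), zero_smul]

lemma eq_dyadicMean_add_sum_haarCoeff (w : ℕ → E) {m i : ℕ} (hi : i < 2 ^ m) :
    w i = dyadicMean w m 0 + ∑ j ∈ Finset.range m, ∑ k ∈ Finset.range (2 ^ (m - (j + 1))),
        haarFeature (j + 1) (k + 1) (i + 1) • haarCoeff w j k := by
  rw [Finset.sum_congr rfl fun j hj =>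
      sum_haarFeature_smul_haarCoeff w hi (Finset.mem_range.1 hj),
    Finset.sum_range_sub' fun j => dyadicMean w j (i / 2 ^ j), Nat.div_eq_of_lt hi, pow_zero,
    Nat.div_one, dyadicMean_zero, add_sub_cancel]

end Module

variable [SeminormedAddCommGroup E] [NormedSpace ℝ E] {w : ℕ → E} {z : E} {B : ℝ}

lemma norm_dyadicMean_sub_le {j k : ℕ} (hB : ∀ i < 2 ^ j, ‖w (2 ^ j * k + i) - z‖ ≤ B) :
    ‖dyadicMean w j k - z‖ ≤ B := by
  simpa [dyadicMean] using norm_inv_card_smul_sum_sub_le (s := Finset.range (2 ^ j))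
    (by simp) fun i hi => hB i (Finset.mem_range.1 hi)

lemma norm_dyadicMean_sub_le_sum (w : ℕ → E) (z : E) (j k : ℕ) :
    ‖dyadicMean w j k - z‖
      ≤ (2 ^ j : ℝ)⁻¹ * ∑ i ∈ Finset.range (2 ^ j), ‖w (2 ^ j * k + i) - z‖ := by
  simpa [dyadicMean] using norm_inv_card_smul_sum_sub_le_sum (s := Finset.range (2 ^ j))
    (f := fun i => w (2 ^ j * k + i)) (z := z) (by simp)

lemma norm_dyadicMean_le (hB : ∀ i, ‖w i‖ ≤ B) (j k : ℕ) : ‖dyadicMean w j k‖ ≤ B := by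
  simpa using norm_dyadicMean_sub_le (w := w) (z := 0) (j := j) (k := k) (B := B)
    (by simpa using fun i _ => hB _)

lemma norm_haarCoeff (w : ℕ → E) (j k : ℕ) :
    ‖haarCoeff w j k‖ = 2⁻¹ * ‖dyadicMean w j (2 * k) - dyadicMean w j (2 * k + 1)‖ := by
  rw [haarCoeff, norm_smul, norm_inv, Real.norm_two]

lemma norm_haarCoeff_le (hB : ∀ i, ‖w i‖ ≤ B) (j k : ℕ) : ‖haarCoeff w j k‖ ≤ B := by
  rw [norm_haarCoeff]
  linarith [norm_sub_le (dyadicMean w j (2 * k)) (dyadicMean w j (2 * k + 1)),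
    norm_dyadicMean_le hB j (2 * k), norm_dyadicMean_le hB j (2 * k + 1)]

lemma norm_sub_le_sum_Ico {E : Type*} [SeminormedAddCommGroup E] (w : ℕ → E) {a b c e : ℕ}
    (hab : a ≤ b) (hbc : b ≤ c) (hce : c ≤ e) :
    ‖w c - w b‖ ≤ ∑ i ∈ Finset.Ico a e, ‖w (i + 1) - w i‖ := by
  rw [← Finset.sum_Ico_sub w hbc]
  exact (norm_sum_le _ _).trans (Finset.sum_le_sum_of_subset_of_nonneg
    (Finset.Ico_subset_Ico hab hce) fun _ _ _ => norm_nonneg _)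

lemma norm_haarCoeff_le_path (w : ℕ → E) (j k : ℕ) :
    ‖haarCoeff w j k‖ ≤ 2⁻¹ * ∑ i ∈ Finset.range (2 ^ (j + 1)),
      ‖w (2 ^ (j + 1) * k + i + 1) - w (2 ^ (j + 1) * k + i)‖ := by
  rw [norm_haarCoeff]
  gcongr
  refine norm_dyadicMean_sub_le fun i hi => ?_
  rw [norm_sub_rev]
  refine norm_dyadicMean_sub_le fun i' hi' => ?_
  have h := norm_sub_le_sum_Ico w (a := 2 ^ (j + 1) * k) (b := 2 ^ j * (2 * k) + i)
    (c := 2 ^ j * (2 * k + 1) + i') (e := 2 ^ (j + 1) * k + 2 ^ (j + 1))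
    (by rw [pow_succ]; nlinarith) (by rw [mul_add]; omega) (by rw [pow_succ]; nlinarith)
  rwa [Finset.sum_Ico_eq_sum_range, Nat.add_sub_cancel_left] at h

lemma norm_haarCoeff_le_variability (w : ℕ → E) (z : E) (j k : ℕ) :
    ‖haarCoeff w j k‖ ≤ (2 ^ (j + 1) : ℝ)⁻¹ * ∑ i ∈ Finset.range (2 ^ (j + 1)),
      ‖w (2 ^ (j + 1) * k + i) - z‖ := by
  rw [norm_haarCoeff, sum_range_two_pow_succ fun i => ‖w i - z‖, pow_succ, mul_inv]
  have htri := norm_sub_le (dyadicMean w j (2 * k) - z) (dyadicMean w j (2 * k + 1) - z)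
  rw [sub_sub_sub_cancel_right] at htri
  linarith [norm_dyadicMean_sub_le_sum w z j (2 * k),
    norm_dyadicMean_sub_le_sum w z j (2 * k + 1)]

lemma mul_sqrt_add_one_le_sqrt_mul_sqrt {x K P S : ℝ} (hx : 0 ≤ x) (hK : 1 ≤ K)
    (hP : x ≤ 2⁻¹ * P) (hS : x ≤ K⁻¹ * S) : x * √(K + 1) ≤ √P * √S := by
  have hP0 : 0 ≤ P := by linarith
  have hKS : K * x ≤ S := by rwa [le_inv_mul_iff₀ (by linarith)] at hS
  rw [← Real.sqrt_mul hP0]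
  apply Real.le_sqrt_of_sq_le
  rw [mul_pow, Real.sq_sqrt (by linarith)]
  calc x ^ 2 * (K + 1) ≤ x ^ 2 * (2 * K) := by gcongr; linarith
    _ = (2 * x) * (K * x) := by ring
    _ ≤ P * S := by
      gcongr
      linarith

lemma sum_norm_haarCoeff_mul_sqrt_le (w : ℕ → E) (z : E) {m j : ℕ} (hj : j < m) :
    ∑ k ∈ Finset.range (2 ^ (m - (j + 1))), ‖haarCoeff w j k‖ * √(2 ^ (j + 1) + 1)
      ≤ √(∑ i ∈ Finset.range (2 ^ m), ‖w (i + 1) - w i‖)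
        * √(∑ i ∈ Finset.range (2 ^ m), ‖w i - z‖) := by
  have hm : 2 ^ m = 2 ^ (j + 1) * 2 ^ (m - (j + 1)) := by
    rw [← pow_add, Nat.add_sub_cancel' hj]
  rw [hm, ← sum_range_sum_range_mul_add, ← sum_range_sum_range_mul_add]
  refine (Finset.sum_le_sum fun k _ => ?_).trans
    (Real.sum_sqrt_mul_sqrt_le _ (fun k => Finset.sum_nonneg fun _ _ => norm_nonneg _)
      fun k => Finset.sum_nonneg fun _ _ => norm_nonneg _)
  exact mul_sqrt_add_one_le_sqrt_mul_sqrt (norm_nonneg _) (one_le_pow₀ one_le_two)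
    (norm_haarCoeff_le_path w j k) (norm_haarCoeff_le_variability w z j k)

end HaarTransform

section HaarDictionary

/-- Indices of the Haar dictionary: `none` for the all-one feature and `some ⟨j, k⟩` for the
feature of scale `j + 1` and location `k + 1`, both shifted so as to start from zero. -/
abbrev HaarIndex : Type := Option (Σ _ : ℕ, ℕ)

/-- The indices of the Haar dictionary of length `2 ^ m`. -/
def haarIndices (m : ℕ) : Finset HaarIndex :=
  Finset.insertNone ((Finset.range m).sigma fun j => Finset.range (2 ^ (m - (j + 1))))

/-- The feature with a given index. -/
def haarAtom : HaarIndex → ℕ → ℝ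
  | none => oneFeature
  | some ⟨j, k⟩ => haarFeature (j + 1) (k + 1)

/-- The length of the support of a feature of the dictionary of length `2 ^ m`. -/
def haarSupport (m : ℕ) : HaarIndex → ℕ
  | none => 2 ^ m
  | some ⟨j, _⟩ => 2 ^ (j + 1)

/-- The coefficients of a sequence in the Haar dictionary of length `2 ^ m`. -/
def haarTransform {E : Type*} [AddCommGroup E] [Module ℝ E] (w : ℕ → E) (m : ℕ) : HaarIndex → E
  | none => dyadicMean w m 0
  | some ⟨j, k⟩ => haarCoeff w j k

lemma sum_haarIndices {M : Type*} [AddCommMonoid M] (f : HaarIndex → M) (m : ℕ) :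
    ∑ p ∈ haarIndices m, f p
      = f none + ∑ j ∈ Finset.range m, ∑ k ∈ Finset.range (2 ^ (m - (j + 1))), f (some ⟨j, k⟩) := by
  rw [haarIndices, Finset.sum_insertNone, Finset.sum_sigma]

lemma card_haarIndices (m : ℕ) : (haarIndices m).card = 2 ^ m := by
  rw [Finset.card_eq_sum_ones, sum_haarIndices]
  simp only [Finset.sum_const, Finset.card_range, smul_eq_mul, mul_one]
  induction m with
  | zero => rfl
  | succ m ih =>
    rw [Finset.sum_range_succ', zero_add, Nat.add_sub_cancel, ← add_assoc]
    simp only [Nat.add_sub_add_right]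
    rw [ih, pow_succ, mul_two]

lemma sum_Icc_one_eq_sum_range {M : Type*} [AddCommMonoid M] (f : ℕ → M) (n : ℕ) :
    ∑ i ∈ Finset.Icc 1 n, f i = ∑ i ∈ Finset.range n, f (i + 1) := by
  rw [← Finset.Ico_add_one_right_eq_Icc, Finset.sum_Ico_eq_sum_range, Nat.add_sub_cancel]
  simp only [add_comm]

lemma haarFixed_eq_sum {d : ℕ} (m : ℕ) (ε G : ℝ) (gs : List (Vec d)) :
    haarFixed m ε G gs
      = ∑ p ∈ haarIndices m, featureLearner (ε / 2 ^ m) G (haarAtom p) gs := by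
  simp only [haarFixed, sum_Icc_one_eq_sum_range, sum_haarIndices, haarAtom]

lemma abs_haarAtom_le_one (p : HaarIndex) (t : ℕ) : |haarAtom p t| ≤ 1 := by
  match p with
  | none => simp [haarAtom, oneFeature]
  | some ⟨j, k⟩ => exact abs_haarFeature_le_one _ _ _

lemma card_filter_haarAtom_le {m n : ℕ} (hn : n ≤ 2 ^ m) (p : HaarIndex) :
    ((Finset.range n).filter fun i => haarAtom p (i + 1) ≠ 0).card ≤ haarSupport m p := by
  match p with
  | none => simpa [haarAtom, oneFeature, haarSupport] using hn
  | some ⟨j, k⟩ => exact card_filter_haarFeature_le j k n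

lemma haarSupport_le {m : ℕ} {p : HaarIndex} (hp : p ∈ haarIndices m) :
    haarSupport m p ≤ 2 ^ m := by
  match p with
  | none => rfl
  | some ⟨j, k⟩ =>
    have hj : j < m := by simp_all [haarIndices]
    exact Nat.pow_le_pow_right two_pos hj

lemma eq_sum_haarAtom_smul_haarTransform {E : Type*} [AddCommGroup E] [Module ℝ E] (w : ℕ → E)
    {m i : ℕ} (hi : i < 2 ^ m) :
    w i = ∑ p ∈ haarIndices m, haarAtom p (i + 1) • haarTransform w m p := by
  rw [sum_haarIndices, eq_dyadicMean_add_sum_haarCoeff w hi]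
  simp only [haarAtom, haarTransform, oneFeature, one_smul]

lemma norm_haarTransform_le {E : Type*} [SeminormedAddCommGroup E] [NormedSpace ℝ E] {w : ℕ → E}
    {B : ℝ} (hB : ∀ i, ‖w i‖ ≤ B) (m : ℕ) (p : HaarIndex) : ‖haarTransform w m p‖ ≤ B := by
  match p with
  | none => exact norm_dyadicMean_le hB m 0
  | some ⟨j, k⟩ => exact norm_haarCoeff_le hB j k

end HaarDictionary

section HorizonRegret

variable {d m n : ℕ} {G M L : ℝ} {g w : ℕ → Vec d}

lemma haarFixed_regret_le (hG : 0 < G) (hg : ∀ i, ‖g i‖ ≤ G) (hn : n ≤ 2 ^ m)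
    (hw : ∀ i, ‖w i‖ ≤ M) (hL : 0 ≤ L) (hML : (2 ^ m + 1) ^ 2 * M * 2 ^ m ≤ Real.exp L) :
    ∑ i ∈ Finset.range n, inner ℝ (g i) (haarFixed m 1 G (initSeg g i) - w i)
      ≤ G + G * (2 * L + √(2 * L))
        * ∑ p ∈ haarIndices m, ‖haarTransform w m p‖ * √(haarSupport m p + 1) := by
  have hbudget : ∀ p ∈ haarIndices m,
      ((haarSupport m p : ℝ) + 1) ^ 2 * ‖haarTransform w m p‖ ≤ 1 / 2 ^ m * Real.exp L := by
    intro p hp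
    have : (haarSupport m p : ℝ) ≤ 2 ^ m := by exact_mod_cast haarSupport_le hp
    rw [one_div_mul_eq_div, le_div_iff₀ (by positivity)]
    refine le_trans ?_ hML
    gcongr
    exact norm_haarTransform_le hw m p
  have hsum := sum_featureLearner_regret_le (n := n) hG (by positivity) hL
    abs_haarAtom_le_one hg (fun p _ => card_filter_haarAtom_le hn p) hbudget
  have hcard : ((haarIndices m).card : ℝ) * (1 / 2 ^ m * G) = G := by
    rw [card_haarIndices, Nat.cast_pow, Nat.cast_ofNat]
    field_simp
  rw [hcard] at hsum
  convert hsum using 4 with i hi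
  · exact haarFixed_eq_sum m 1 G _
  · exact eq_sum_haarAtom_smul_haarTransform w ((Finset.mem_range.1 hi).trans_le hn)

variable {P S : ℝ} {z : Vec d}

lemma norm_dyadicMean_mul_sqrt_le (hP : ∀ i, ‖w i - z‖ ≤ P)
    (hS : ∑ i ∈ Finset.range (2 ^ m), ‖w i - z‖ ≤ S) :
    ‖dyadicMean w m 0‖ * √(2 ^ m + 1) ≤ ‖z‖ * √(2 ^ m + 1) + 2 * √(P * S) := by
  have hP0 : 0 ≤ P := (norm_nonneg _).trans (hP 0)
  have hdist : ‖dyadicMean w m 0 - z‖ ≤ 2⁻¹ * (2 * P) := by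
    rw [inv_mul_cancel_left₀ two_ne_zero]
    exact norm_dyadicMean_sub_le fun i _ => hP _
  have hmean : ‖dyadicMean w m 0 - z‖ ≤ (2 ^ m : ℝ)⁻¹ * S := by
    refine (norm_dyadicMean_sub_le_sum w z m 0).trans ?_
    gcongr
    simpa using hS
  have hdev : ‖dyadicMean w m 0 - z‖ * √(2 ^ m + 1) ≤ 2 * √(P * S) := by
    refine (mul_sqrt_add_one_le_sqrt_mul_sqrt (norm_nonneg _) (one_le_pow₀ one_le_two)
      hdist hmean).trans ?_
    rw [Real.sqrt_mul zero_le_two, Real.sqrt_mul hP0, mul_assoc]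
    gcongr
    exact Real.sqrt_le_iff.2 ⟨by norm_num, by norm_num⟩
  have htri : ‖dyadicMean w m 0‖ ≤ ‖z‖ + ‖dyadicMean w m 0 - z‖ := norm_le_insert' _ _
  calc ‖dyadicMean w m 0‖ * √(2 ^ m + 1)
      ≤ (‖z‖ + ‖dyadicMean w m 0 - z‖) * √(2 ^ m + 1) := by gcongr
    _ ≤ ‖z‖ * √(2 ^ m + 1) + 2 * √(P * S) := by
      rw [add_mul]
      gcongr

lemma sum_norm_haarTransform_mul_sqrt_le
    (hP : ∑ i ∈ Finset.range (2 ^ m), ‖w (i + 1) - w i‖ ≤ P) (hPz : ∀ i, ‖w i - z‖ ≤ P)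
    (hS : ∑ i ∈ Finset.range (2 ^ m), ‖w i - z‖ ≤ S) :
    ∑ p ∈ haarIndices m, ‖haarTransform w m p‖ * √(haarSupport m p + 1)
      ≤ ‖z‖ * √(2 ^ m + 1) + (m + 2) * √(P * S) := by
  have hP0 : 0 ≤ P := (norm_nonneg _).trans (hPz 0)
  have hdetail : ∑ j ∈ Finset.range m, ∑ k ∈ Finset.range (2 ^ (m - (j + 1))),
      ‖haarCoeff w j k‖ * √(2 ^ (j + 1) + 1) ≤ m * √(P * S) := by
    refine (Finset.sum_le_card_nsmul _ _ (√(P * S)) fun j hj => ?_).trans_eq (by simp)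
    refine (sum_norm_haarCoeff_mul_sqrt_le w z (Finset.mem_range.1 hj)).trans ?_
    rw [Real.sqrt_mul hP0]
    gcongr
  rw [sum_haarIndices]
  simp only [haarTransform, haarSupport, Nat.cast_pow, Nat.cast_ofNat]
  linarith [norm_dyadicMean_mul_sqrt_le hPz hS]

end HorizonRegret

section Comparator

variable {d T : ℕ}

/-- A finite comparator sequence, numbered from `0` and continued by its average, so that the block
of Haar OLR interrupted at time `T` can be compared with a sequence filling the whole block. -/
def extendByAverage (u : Fin T → Vec d) (i : ℕ) : Vec d :=
  if h : i < T then u ⟨i, h⟩ else average u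

lemma extendByAverage_of_lt (u : Fin T → Vec d) {i : ℕ} (hi : i < T) :
    extendByAverage u i = u ⟨i, hi⟩ := dif_pos hi

lemma extendByAverage_of_le (u : Fin T → Vec d) {i : ℕ} (hi : T ≤ i) :
    extendByAverage u i = average u := dif_neg (by omega)

lemma norm_average_sub_le (hT : 0 < T) {u : Fin T → Vec d} {z : Vec d} {B : ℝ}
    (hB : ∀ t, ‖u t - z‖ ≤ B) : ‖average u - z‖ ≤ B := by
  have : Nonempty (Fin T) := ⟨⟨0, hT⟩⟩
  simpa [average] using norm_inv_card_smul_sum_sub_le Finset.univ_nonempty fun t _ => hB t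

lemma norm_le_maxRange (u : Fin T → Vec d) (t : Fin T) : ‖u t‖ ≤ maxRange u :=
  le_ciSup (f := fun t => ‖u t‖) (Set.finite_range _).bddAbove t

lemma maxRange_nonneg (u : Fin T → Vec d) : 0 ≤ maxRange u :=
  Real.iSup_nonneg fun _ => norm_nonneg _

lemma norm_extendByAverage_le (hT : 0 < T) (u : Fin T → Vec d) (i : ℕ) :
    ‖extendByAverage u i‖ ≤ maxRange u := by
  unfold extendByAverage
  split_ifs
  · exact norm_le_maxRange u _
  · simpa using norm_average_sub_le hT (z := 0) (by simpa using norm_le_maxRange u)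

lemma pathLength_nonneg (u : Fin T → Vec d) : 0 ≤ pathLength u :=
  Finset.sum_nonneg fun _ _ => norm_nonneg _

lemma pathLength_eq_sum_range (u : Fin T → Vec d) :
    pathLength u
      = ∑ i ∈ Finset.range (T - 1), ‖extendByAverage u (i + 1) - extendByAverage u i‖ := by
  rw [Finset.sum_range]
  refine Finset.sum_congr rfl fun t _ => ?_
  rw [extendByAverage_of_lt u (by omega : (t : ℕ) + 1 < T),
    extendByAverage_of_lt u (by omega : (t : ℕ) < T)]

lemma norm_sub_le_pathLength (u : Fin T → Vec d) (s t : Fin T) : ‖u t - u s‖ ≤ pathLength u := by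
  wlog hst : s ≤ t generalizing s t
  · rw [norm_sub_rev]
    exact this t s (le_of_not_ge hst)
  have h := norm_sub_le_sum_Ico (extendByAverage u) (Nat.zero_le s) (Fin.le_def.1 hst)
    (Nat.le_sub_one_of_lt t.2)
  rwa [extendByAverage_of_lt u s.2, extendByAverage_of_lt u t.2, ← Finset.range_eq_Ico,
    ← pathLength_eq_sum_range] at h

lemma norm_extendByAverage_sub_average_le (u : Fin T → Vec d) (i : ℕ) :
    ‖extendByAverage u i - average u‖ ≤ pathLength u := by
  rcases lt_or_ge i T with h | h
  · rw [extendByAverage_of_lt u h, norm_sub_rev]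
    exact norm_average_sub_le (by omega) (norm_sub_le_pathLength u ⟨i, h⟩)
  · rw [extendByAverage_of_le u h, sub_self, norm_zero]
    exact pathLength_nonneg u

lemma sum_range_shift_le_sum_range {f : ℕ → ℝ} (hf : ∀ i, 0 ≤ f i) (hT : ∀ i, T ≤ i → f i = 0)
    (a n : ℕ) : ∑ i ∈ Finset.range n, f (a + i) ≤ ∑ i ∈ Finset.range T, f i := by
  calc ∑ i ∈ Finset.range n, f (a + i)
      ≤ ∑ i ∈ Finset.range a, f i + ∑ i ∈ Finset.range n, f (a + i) :=
        le_add_of_nonneg_left (Finset.sum_nonneg fun i _ => hf i)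
    _ = ∑ i ∈ Finset.range (a + n), f i := (Finset.sum_range_add f a n).symm
    _ ≤ ∑ i ∈ Finset.range (T + (a + n)), f i :=
        Finset.sum_le_sum_of_subset_of_nonneg (Finset.range_mono (by omega)) fun i _ _ => hf i
    _ = ∑ i ∈ Finset.range T, f i := by
        rw [Finset.sum_range_add, Finset.sum_eq_zero (s := Finset.range (a + n)), add_zero]
        exact fun i _ => hT _ (by omega)

lemma sum_norm_extendByAverage_sub_average_le (u : Fin T → Vec d) (a n : ℕ) :
    ∑ i ∈ Finset.range n, ‖extendByAverage u (a + i) - average u‖ ≤ variability u := by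
  refine (sum_range_shift_le_sum_range (f := fun i => ‖extendByAverage u i - average u‖) (T := T)
    (fun _ => norm_nonneg _) (fun i hi => by simp [extendByAverage_of_le u hi]) a n).trans_eq ?_
  rw [Finset.sum_range]
  exact Finset.sum_congr rfl fun t _ => by rw [extendByAverage_of_lt u t.2]

lemma sum_norm_extendByAverage_succ_sub_le (hT : 0 < T) (u : Fin T → Vec d) (a n : ℕ) :
    ∑ i ∈ Finset.range n, ‖extendByAverage u (a + (i + 1)) - extendByAverage u (a + i)‖
      ≤ 2 * pathLength u := by
  refine (sum_range_shift_le_sum_range (T := T)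
    (f := fun i => ‖extendByAverage u (i + 1) - extendByAverage u i‖)
    (fun _ => norm_nonneg _) (fun i hi => by
      rw [extendByAverage_of_le u hi, extendByAverage_of_le u (by omega), sub_self, norm_zero])
    a n).trans ?_
  obtain ⟨T, rfl⟩ := Nat.exists_eq_add_one.2 hT
  rw [Finset.sum_range_succ, extendByAverage_of_le u le_rfl, norm_sub_rev (average u), two_mul]
  exact add_le_add (pathLength_eq_sum_range u).ge (norm_extendByAverage_sub_average_le u T)

end Comparator

section Doubling

lemma natLog_two_le_two_mul_log (n : ℕ) : (Nat.log 2 n : ℝ) ≤ 2 * Real.log n := by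
  refine (Real.natLog_le_logb n 2).trans ?_
  rw [Real.logb, Nat.cast_ofNat, div_le_iff₀ (Real.log_pos one_lt_two)]
  nlinarith [Real.log_two_gt_d9, Real.log_natCast_nonneg n]

lemma sum_range_le_natLog_mul {f : ℕ → ℝ} {B : ℝ} {T : ℕ} (hB : 0 ≤ B)
    (hblock : ∀ m n : ℕ, 1 ≤ m → 2 ^ m ≤ T + 1 → n ≤ 2 ^ m →
      ∑ i ∈ Finset.range n, f (2 ^ m - 2 + i) ≤ B) :
    ∑ i ∈ Finset.range T, f i ≤ Nat.log 2 (T + 1) * B := by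
  have hblocks : ∀ b n : ℕ, n ≤ T → n ≤ 2 ^ (b + 1) - 2 → ∑ i ∈ Finset.range n, f i ≤ b * B := by
    intro b
    induction b with
    | zero =>
      intro n _ hn
      obtain rfl : n = 0 := by simpa using hn
      simp
    | succ b ih =>
      intro n hnT hn
      rw [Nat.cast_succ, add_one_mul]
      rcases le_or_gt n (2 ^ (b + 1) - 2) with h | h
      · linarith [ih n hnT h]
      · obtain ⟨c, rfl⟩ := Nat.exists_eq_add_of_le h.le
        have : 2 ≤ 2 ^ (b + 1) := Nat.le_self_pow (by omega) 2
        rw [pow_succ 2 (b + 1)] at hn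
        rw [Finset.sum_range_add]
        exact add_le_add (ih _ (by omega) le_rfl)
          (hblock (b + 1) c (by omega) (by omega) (by omega))
  refine hblocks _ T le_rfl ?_
  have := Nat.lt_pow_succ_log_self one_lt_two (T + 1)
  omega

end Doubling

section AnytimeRegret

variable {d m n T : ℕ} {G : ℝ} {g : ℕ → Vec d}

lemma anytimeHaar_initSeg (G : ℝ) (g : ℕ → Vec d) (hm : 1 ≤ m) (hn : n < 2 ^ m) :
    anytimeHaar G (initSeg g (2 ^ m - 2 + n))
      = haarFixed m 1 G (initSeg (fun i => g (2 ^ m - 2 + i)) n) := by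
  have : 2 ≤ 2 ^ m := Nat.le_self_pow (by omega) 2
  have hlog : Nat.log 2 (2 ^ m - 2 + n + 2) = m :=
    Nat.log_eq_of_pow_le_of_lt_pow (by omega) (by rw [pow_succ]; omega)
  simp only [anytimeHaar, length_initSeg, hlog, drop_initSeg_add]

lemma one_le_log_two_add_maxRange_add (hT : 1 ≤ T) (u : Fin T → Vec d) :
    1 ≤ Real.log (2 + maxRange u + T) := by
  have : (1 : ℝ) ≤ T := by exact_mod_cast hT
  have := maxRange_nonneg u
  rw [Real.le_log_iff_exp_le (by linarith)]
  linarith [Real.exp_one_lt_d9]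

lemma sq_mul_mul_le_exp_four_mul_log {N M X : ℝ} (hN : 0 ≤ N) (hM : 0 ≤ M) (hX : 0 < X)
    (hNX : N + 1 ≤ X) (hMX : M ≤ X) : (N + 1) ^ 2 * M * N ≤ Real.exp (4 * Real.log X) := by
  calc (N + 1) ^ 2 * M * N ≤ X ^ 2 * X * X := by gcongr; linarith
    _ = X ^ 4 := by ring
    _ = Real.exp (4 * Real.log X) := by
      rw [← Real.exp_log (pow_pos hX 4), Real.log_pow, Nat.cast_ofNat]

lemma log_factor_mul_add_le {ℓ N p x y t : ℝ} (hℓ : 1 ≤ ℓ) (hp0 : 0 ≤ p) (hp : p ≤ 2 * ℓ)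
    (hx : 0 ≤ x) (ht : 1 ≤ t) (hN : N ≤ t + 1) :
    (2 * (4 * ℓ) + √(2 * (4 * ℓ))) * (x * √(N + 1) + (p + 2) * √(2 * y))
      ≤ 128 * ℓ ^ 2 * (x * √t + √y) := by
  have hfactor : 2 * (4 * ℓ) + √(2 * (4 * ℓ)) ≤ 16 * ℓ := by
    have : √(2 * (4 * ℓ)) ≤ 8 * ℓ := Real.sqrt_le_iff.2 ⟨by linarith, by nlinarith⟩
    linarith
  have hhorizon : √(N + 1) ≤ 2 * √t := by
    refine Real.sqrt_le_iff.2 ⟨by positivity, ?_⟩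
    rw [mul_pow, Real.sq_sqrt (by positivity)]
    linarith
  have htwo : √(2 * y) ≤ 2 * √y := by
    rw [Real.sqrt_mul zero_le_two]
    gcongr
    exact Real.sqrt_le_iff.2 ⟨by norm_num, by norm_num⟩
  calc (2 * (4 * ℓ) + √(2 * (4 * ℓ))) * (x * √(N + 1) + (p + 2) * √(2 * y))
      ≤ 16 * ℓ * (x * (2 * √t) + (2 * ℓ + 2 * ℓ) * (2 * √y)) := by
        gcongr
        linarith
    _ = 16 * ℓ * (2 * (x * √t) + 8 * ℓ * √y) := by ring
    _ ≤ 16 * ℓ * (8 * ℓ * (x * √t) + 8 * ℓ * √y) := by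
        gcongr
        linarith
    _ = 128 * ℓ ^ 2 * (x * √t + √y) := by ring

lemma anytimeHaar_block_regret_le (hG : 0 < G) (hg : ∀ i, ‖g i‖ ≤ G) (hT : 1 ≤ T)
    (u : Fin T → Vec d) (hm : 1 ≤ m) (hmT : 2 ^ m ≤ T + 1) (hn : n ≤ 2 ^ m) :
    ∑ i ∈ Finset.range n, inner ℝ (g (2 ^ m - 2 + i))
        (anytimeHaar G (initSeg g (2 ^ m - 2 + i)) - extendByAverage u (2 ^ m - 2 + i))
      ≤ G + G * (128 * Real.log (2 + maxRange u + T) ^ 2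
        * (‖average u‖ * √T + √(pathLength u * variability u))) := by
  have hM := maxRange_nonneg u
  have hT' : (1 : ℝ) ≤ T := by exact_mod_cast hT
  have hhorizon : (2 : ℝ) ^ m ≤ T + 1 := by exact_mod_cast hmT
  have hℓ := one_le_log_two_add_maxRange_add hT u
  have hmℓ : (m : ℝ) ≤ 2 * Real.log (2 + maxRange u + T) := by
    calc (m : ℝ) ≤ Nat.log 2 (T + 1) := by exact_mod_cast Nat.le_log_of_pow_le one_lt_two hmT
      _ ≤ 2 * Real.log ((T + 1 : ℕ) : ℝ) := natLog_two_le_two_mul_log _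
      _ ≤ 2 * Real.log (2 + maxRange u + T) := by
        gcongr
        push_cast
        linarith
  rw [Finset.sum_congr rfl fun i hi => by
    rw [anytimeHaar_initSeg G g hm ((Finset.mem_range.1 hi).trans_le hn)]]
  refine (haarFixed_regret_le hG (fun i => hg _) hn (fun i => norm_extendByAverage_le hT u _)
    (by linarith) (sq_mul_mul_le_exp_four_mul_log (by positivity) hM (by linarith)
      (by linarith) (by linarith))).trans ?_
  rw [mul_assoc G]
  gcongr G + G * ?_
  refine le_trans ?_ (log_factor_mul_add_le hℓ m.cast_nonneg hmℓ (norm_nonneg _) hT' hhorizon)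
  gcongr
  rw [← mul_assoc 2]
  exact sum_norm_haarTransform_mul_sqrt_le (sum_norm_extendByAverage_succ_sub_le hT u _ _)
    (fun i => (norm_extendByAverage_sub_average_le u _).trans (by linarith [pathLength_nonneg u]))
    (sum_norm_extendByAverage_sub_average_le u _ _)

lemma anytimeHaar_linear_regret_le (hG : 0 < G) (hg : ∀ i, ‖g i‖ ≤ G) (hT : 1 ≤ T)
    (u : Fin T → Vec d) :
    ∑ t : Fin T, inner ℝ (g t) (anytimeHaar G (initSeg g t) - u t)
      ≤ Nat.log 2 (T + 1) * (G + G * (128 * Real.log (2 + maxRange u + T) ^ 2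
        * (‖average u‖ * √T + √(pathLength u * variability u)))) := by
  rw [Finset.sum_congr rfl fun t _ => by rw [← extendByAverage_of_lt u t.2],
    ← Finset.sum_range fun i =>
      inner ℝ (g i) (anytimeHaar G (initSeg g i) - extendByAverage u i)]
  exact sum_range_le_natLog_mul (by positivity) fun m n => anytimeHaar_block_regret_le hG hg hT u

end AnytimeRegret

section ConvexLosses

lemma norm_le_of_subgradient_of_lipschitz {E : Type*} [NormedAddCommGroup E]
    [InnerProductSpace ℝ E] {f : E → ℝ} {K : NNReal} {x v : E} (hf : LipschitzWith K f)
    (hv : ∀ y, f x + inner ℝ v (y - x) ≤ f y) : ‖v‖ ≤ K := by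
  have hsub := hv (x + v)
  have hlip := (le_abs_self _).trans (hf.dist_le_mul (x + v) x)
  rw [add_sub_cancel_left, real_inner_self_eq_norm_sq] at hsub
  rw [dist_eq_norm, add_sub_cancel_left] at hlip
  by_contra! hlt
  nlinarith [K.coe_nonneg]

variable {d : ℕ} {G : ℝ}

/-- The subgradients revealed during a play, numbered from `0`. -/
def gradAt (A : Learner d) (env : Environment d G) (t : ℕ) : Vec d :=
  env.grad (play A env t).1 (prediction A env t)

lemma norm_gradAt_le (hG : 0 ≤ G) (A : Learner d) (env : Environment d G) (t : ℕ) :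
    ‖gradAt A env t‖ ≤ G := by
  exact (norm_le_of_subgradient_of_lipschitz (env.lipschitz _ _) (env.subgradient _ _)).trans_eq
    (Real.coe_toNNReal G hG)

lemma play_snd_eq_initSeg (A : Learner d) (env : Environment d G) (t : ℕ) :
    (play A env t).2 = initSeg (gradAt A env) t := by
  induction t with
  | zero => rfl
  | succ t ih => rw [initSeg_succ, ← ih]; rfl

lemma regret_le_of_linear_regret_le (hG : 0 ≤ G) {A : Learner d} {T : ℕ} {u : Fin T → Vec d}
    {R : ℝ} (hR : ∀ g : ℕ → Vec d, (∀ i, ‖g i‖ ≤ G) →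
      ∑ t : Fin T, inner ℝ (g t) (A (initSeg g t) - u t) ≤ R) :
    regret A G u ≤ R := by
  refine iSup_le fun env => EReal.coe_le_coe_iff.2 ?_
  refine le_trans ?_ (hR (gradAt A env) (norm_gradAt_le hG A env))
  rw [← Finset.sum_sub_distrib]
  refine Finset.sum_le_sum fun t _ => ?_
  have hsub : lossAt A env t (prediction A env t)
      + inner ℝ (gradAt A env t) (u t - prediction A env t) ≤ lossAt A env t (u t) :=
    env.subgradient _ _ _
  have hpred : A (initSeg (gradAt A env) t) = prediction A env t := by
    rw [← play_snd_eq_initSeg, prediction]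
  rw [hpred, ← neg_sub (u t), inner_neg_right]
  linarith

end ConvexLosses

end HaarOLR

end

theorem theorem3 :
    ∃ (C : ℝ) (k : ℕ), 0 < C ∧
      ∀ (d : ℕ) (G : ℝ), 0 < G → ∀ (T : ℕ), 1 ≤ T → ∀ (u : Fin T → HaarOLR.Vec d),
        HaarOLR.regret (HaarOLR.anytimeHaar G) G u ≤
          ((C * G * Real.log (T + 1)
            + C * G * (‖HaarOLR.average u‖ * √(T : ℝ)
                + √(HaarOLR.pathLength u * HaarOLR.variability u))
              * Real.log (2 + HaarOLR.maxRange u + T) ^ k : ℝ) : EReal) := by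
  refine ⟨256, 3, by norm_num, fun d G hG T hT u => ?_⟩
  refine HaarOLR.regret_le_of_linear_regret_le hG.le fun g hg =>
    (HaarOLR.anytimeHaar_linear_regret_le hG hg hT u).trans ?_
  set ℓ := Real.log (2 + HaarOLR.maxRange u + T)
  set Q := ‖HaarOLR.average u‖ * √(T : ℝ) + √(HaarOLR.pathLength u * HaarOLR.variability u)
  have hblocks : (Nat.log 2 (T + 1) : ℝ) ≤ 2 * Real.log (T + 1) := by
    exact_mod_cast HaarOLR.natLog_two_le_two_mul_log (T + 1)
  have hlog : 0 ≤ Real.log ((T : ℝ) + 1) := Real.log_nonneg (by simp)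
  have hlogℓ : Real.log (T + 1) ≤ ℓ :=
    Real.log_le_log (by positivity) (by linarith [HaarOLR.maxRange_nonneg u])
  calc Nat.log 2 (T + 1) * (G + G * (128 * ℓ ^ 2 * Q))
      ≤ 2 * Real.log (T + 1) * (G + G * (128 * ℓ ^ 2 * Q)) := by gcongr
    _ = 2 * G * Real.log (T + 1) + 256 * G * Q * ℓ ^ 2 * Real.log (T + 1) := by ring
    _ ≤ 256 * G * Real.log (T + 1) + 256 * G * Q * ℓ ^ 2 * ℓ := by gcongr; norm_num
    _ = 256 * G * Real.log (T + 1) + 256 * G * Q * ℓ ^ 3 := by ring
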